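/- Let $k,n$ be integers with $1<k\le n^2$. Let $|\Psi_1\rangle,\dots,|\Psi_k\rangle$ be orthonormal vectors in $\mathbb C^n\otimes\mathbb C^n$, the first factor held by Alice and the second by Bob, and suppose that they share $|\Psi_V\rangle$, where $V$ is uniformly distributed on $\{1,\dots,k\}$. They apply an LOCC protocol: step by step, and depending on all outcomes announced so far, one of the parties performs a measurement with finitely many outcomes on her or his own system (given by Kraus operators $K_j$ with $\sum_j K_j^\dagger K_j=I$) and announces the outcome; the parties may adjoin finite-dimensional ancillas and apply local isometries. The number of rounds need not be bounded, but the protocol terminates with probability one on every input state. Let $Y$ denote the complete record of measurement outcomes, and let $I(V;Y)=H(V)-H(V\mid Y)$ be the mutual information, where $H$ is the Shannon entropy; entropies and all logarithms below are taken to the same base. Put $$I_{\mathrm{LOCC}}(\Psi_1,\dots,\Psi_k)=\sup I(V;Y),$$ the supremum over all such protocols, and $$g(k,n)=\min I_{\mathrm{LOCC}}(\Psi_1,\dots,\Psi_k),$$ the minimum over all families of $k$ orthonormal vectors in $\mathbb C^n\otimes\mathbb C^n$. Then the supremum is finite, the minimum is attained, and $$\frac{2}{k}\log 2\;\le\; g(k,n)\;\le\;\log\lceil\sqrt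 k\,\rceil .$$ -/

import Mathlib

open scoped Matrix Kronecker

/-- The Hilbert space `ℂⁿ ⊗ ℂⁿ`, in coordinates: Alice holds the first index, Bob the second. -/
abbrev BipartiteSpace (n : ℕ) : Type := EuclideanSpace ℂ (Fin n × Fin n)

/-- What happens after a given sequence of announced outcomes: the protocol halts, Alice
measures, or Bob measures. -/
inductive LOCCMove : Type
  | halt
  | alice
  | bob

/-- The instructions of a two-party protocol of local operations and classical communication
on `ℂⁿ ⊗ ℂⁿ`.

A history is the list of the outcomes announced so far, the *latest outcome first*. After the
history `h` the local spaces of Alice and Bob are `ℂ^(dA h)` and `ℂ^(dB h)`; ancillas may be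
adjoined at any time, so the Kraus operators are rectangular. At the start each party applies
a local isometry. When it is Alice's turn she performs a measurement with the `outcomes h`
Kraus operators `KA h 0, KA h 1, …` (so `∑ j, (KA h j)ᴴ * KA h j = 1`) and announces the
outcome `j`, upon which Bob may apply a local isometry `KB h j` (for instance the identity, or
adjoining an ancilla). Bob's turns are the same with the roles exchanged.
There is no bound on the number of rounds. -/
structure LOCCInstructions (n : ℕ) where
  dA : List ℕ → ℕ
  dB : List ℕ → ℕ
  initA : Matrix (Fin (dA [])) (Fin n) ℂ
  initB : Matrix (Fin (dB [])) (Fin n) ℂ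
  move : List ℕ → LOCCMove
  outcomes : List ℕ → ℕ
  KA : (h : List ℕ) → (j : ℕ) → Matrix (Fin (dA (j :: h))) (Fin (dA h)) ℂ
  KB : (h : List ℕ) → (j : ℕ) → Matrix (Fin (dB (j :: h))) (Fin (dB h)) ℂ
  initA_isometry : initAᴴ * initA = 1
  initB_isometry : initBᴴ * initB = 1
  alice_measures : ∀ h, move h = LOCCMove.alice →
    ∑ j ∈ Finset.range (outcomes h), (KA h j)ᴴ * KA h j = 1 ∧
      ∀ j < outcomes h, (KB h j)ᴴ * KB h j = 1
  bob_measures : ∀ h, move h = LOCCMove.bob →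
    ∑ j ∈ Finset.range (outcomes h), (KB h j)ᴴ * KB h j = 1 ∧
      ∀ j < outcomes h, (KA h j)ᴴ * KA h j = 1

namespace LOCCInstructions

variable {n : ℕ}

/-- The operator that Alice has applied in total along a history. -/
def opA (T : LOCCInstructions n) : (h : List ℕ) → Matrix (Fin (T.dA h)) (Fin n) ℂ
  | [] => T.initA
  | j :: h => T.KA h j * T.opA h

/-- The operator that Bob has applied in total along a history. -/
def opB (T : LOCCInstructions n) : (h : List ℕ) → Matrix (Fin (T.dB h)) (Fin n) ℂ
  | [] => T.initB
  | j :: h => T.KB h j * T.opB h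

/-- `h` is a history that the instructions can lead to. -/
def Reached (T : LOCCInstructions n) : List ℕ → Prop
  | [] => True
  | j :: h => T.Reached h ∧ T.move h ≠ LOCCMove.halt ∧ j < T.outcomes h

/-- `h` is a complete record of outcomes: a possible history after which the protocol halts. -/
def IsRecord (T : LOCCInstructions n) (h : List ℕ) : Prop :=
  T.Reached h ∧ T.move h = LOCCMove.halt

open Classical in
/-- The probability that, on the shared input state `ψ`, the complete record of outcomes of the
protocol is `h`: the squared norm of the unnormalized final state `(A_h ⊗ B_h) ψ`. -/
noncomputable def prob (T : LOCCInstructions n) (ψ : BipartiteSpace n) (h : List ℕ) : ℝ :=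
  if T.IsRecord h then
    ‖WithLp.toLp 2 ((T.opA h ⊗ₖ T.opB h) *ᵥ WithLp.ofLp ψ)‖ ^ 2
  else 0

end LOCCInstructions

/-- An LOCC protocol: instructions that terminate with probability one on every input state. -/
structure LOCCProtocol (n : ℕ) extends LOCCInstructions n where
  terminates : ∀ ψ : BipartiteSpace n, ‖ψ‖ = 1 →
    HasSum (fun h : List ℕ => toLOCCInstructions.prob ψ h) 1

/-- Shannon entropy (in nats) of a distribution on a finite set. -/
noncomputable def shannonEntropy {ι : Type*} [Fintype ι] (q : ι → ℝ) : ℝ :=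
  ∑ i, Real.negMulLog (q i)

/-- The mutual information `I(V; Y) = H(V) - H(V | Y)` of a pair `(V, Y)` with joint
distribution `p v y`, where `V` takes values in a finite set and `Y` is discrete, with
`H(V | Y) = ∑ y, P(Y = y) H(V | Y = y)`. For a probability distribution `p` the sums over `y`
converge, because `0 ≤ H(V | Y = y) ≤ log |ι|`; the terms with `P(Y = y) = 0` vanish. -/
noncomputable def mutualInformation {ι Ω : Type*} [Fintype ι] (p : ι → Ω → ℝ) : ℝ :=
  shannonEntropy (fun v => ∑' y, p v y) -
    ∑' y, (∑ v, p v y) * shannonEntropy (fun v => p v y / ∑ w, p w y)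

/-- The mutual information between the identity `V` of the input state, uniformly distributed
over `ψ 0, …, ψ (k - 1)`, and the complete record of outcomes of the protocol `P`. -/
noncomputable def protocolInformation {k n : ℕ} (ψ : Fin k → BipartiteSpace n)
    (P : LOCCProtocol n) : ℝ :=
  mutualInformation (fun (i : Fin k) (h : List ℕ) => (1 / (k : ℝ)) * P.prob (ψ i) h)

/-- The optimal mutual information that LOCC protocols achieve on equally likely states. -/
noncomputable def loccInformation {k n : ℕ} (ψ : Fin k → BipartiteSpace n) : ℝ :=
  ⨆ P : LOCCProtocol n, protocolInformation ψ P

/-- `g(k,n)`: the worst case of the optimal LOCC mutual information over all families of `k`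
orthogonal states in `ℂⁿ ⊗ ℂⁿ`. -/
noncomputable def worstCaseInformation (k n : ℕ) : ℝ :=
  ⨅ ψ : {ψ : Fin k → BipartiteSpace n // Orthonormal ℂ ψ}, loccInformation ψ.1

/-! The mutual information is a sum over records of nonnegative terms `infoTerm`, so both bounds are
proved record by record, using only `x - t ≤ x log (x / t)`.

Upper bound: let `m = ⌈√k⌉` and take `k` of the `m²` generalized Bell states of `ℂᵐ ⊗ ℂᵐ`. A record
acts by a product operator, and Cauchy–Schwarz bounds its probability on each Bell state by `m Q`,
where `Q` is its average probability over a product basis (`prob_bellState_le`). If `S` is its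
probability on the ensemble, `infoTerm_le` bounds its contribution by `S log m + (Q - S)`. Both `Q`
and `S` sum to 1 over the records, which leaves `log m`.

Lower bound: two orthogonal states `φ`, `ψ` can be distinguished perfectly
(`exists_protocol_distinguishing`). The operator `Tr_B |ψ⟩⟨φ|` has trace zero, hence zero diagonal
in some orthonormal basis; if Alice measures in that basis, Bob is left with orthogonal states.
Every record then excludes one of two values of `V`, and `mul_log_two_le_infoTerm` applies.

The minimum is attained because the optimal information is lower semicontinuous on the compact set
of orthonormal families. -/

/-! ### Entropy inequalities for a single outcome. -/

theorem sub_le_mul_log_sub {x t : ℝ} (hx : 0 ≤ x) (ht : 0 < t) :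
    x - t ≤ x * Real.log x - x * Real.log t := by
  rcases hx.eq_or_lt with rfl | hx
  · simp [ht.le]
  · have h := Real.one_sub_inv_le_log_of_pos (div_pos hx ht)
    rw [Real.log_div hx.ne' ht.ne'] at h
    have h2 := mul_le_mul_of_nonneg_left h hx.le
    have h3 : x * (1 - (x / t)⁻¹) = x - t := by field_simp
    rw [h3] at h2
    linarith

/-- The contribution of one value of `Y`, with joint probabilities `x`, to the mutual information
of `Y` and a uniformly distributed variable with values in `ι`. -/
noncomputable def infoTerm {ι : Type*} [Fintype ι] (x : ι → ℝ) : ℝ :=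
  (∑ i, x i) * Real.log (Fintype.card ι) - ∑ i, Real.negMulLog (x i) + Real.negMulLog (∑ i, x i)

section
variable {ι : Type*} [Fintype ι]

theorem continuous_infoTerm : Continuous (infoTerm : (ι → ℝ) → ℝ) := by
  unfold infoTerm
  have := Real.continuous_negMulLog
  fun_prop

theorem infoTerm_eq_zero {x : ι → ℝ} (hx : ∀ i, x i = 0) : infoTerm x = 0 := by
  simp [infoTerm, hx]

/-- This is the unnormalized relative entropy of `x` with respect to the constant vector of the same
total mass, a form in which termwise estimates apply. -/
theorem infoTerm_eq_sum [Nonempty ι] {x : ι → ℝ} (hS : 0 < ∑ i, x i) :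
    infoTerm x = ∑ i, (x i * Real.log (x i) -
      x i * Real.log ((∑ i, x i) / Fintype.card ι)) := by
  have hk : (Fintype.card ι : ℝ) ≠ 0 := by positivity
  rw [Finset.sum_sub_distrib, ← Finset.sum_mul, Real.log_div hS.ne' hk, infoTerm]
  simp only [Real.negMulLog, neg_mul, Finset.sum_neg_distrib]
  ring

theorem sum_mul_shannonEntropy {x : ι → ℝ} (hx : ∀ i, 0 ≤ x i) :
    (∑ i, x i) * shannonEntropy (fun i => x i / ∑ j, x j) =
      (∑ i, x i) * Real.log (Fintype.card ι) - infoTerm x := by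
  rcases (Finset.sum_nonneg fun i _ => hx i).eq_or_lt with h | h
  · have h0 : ∀ i, x i = 0 := fun i =>
      (Finset.sum_eq_zero_iff_of_nonneg fun i _ => hx i).1 h.symm i (Finset.mem_univ i)
    rw [infoTerm_eq_zero h0, ← h]
    simp
  · have key : ∀ i, (∑ j, x j) * Real.negMulLog (x i / ∑ j, x j) =
        Real.negMulLog (x i) + x i * Real.log (∑ j, x j) := fun i => by
      rcases (hx i).eq_or_lt with hi | hi
      · simp [← hi]
      · rw [Real.negMulLog, Real.negMulLog, Real.log_div hi.ne' h.ne']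
        field_simp
        ring
    rw [shannonEntropy, Finset.mul_sum, Finset.sum_congr rfl fun i _ => key i,
      Finset.sum_add_distrib, ← Finset.sum_mul, infoTerm, Real.negMulLog]
    ring

theorem infoTerm_nonneg {x : ι → ℝ} (hx : ∀ i, 0 ≤ x i) : 0 ≤ infoTerm x := by
  rcases (Finset.sum_nonneg fun i _ => hx i).eq_or_lt with h | h
  · exact (infoTerm_eq_zero fun i =>
      (Finset.sum_eq_zero_iff_of_nonneg fun i _ => hx i).1 h.symm i (Finset.mem_univ i)).ge
  · have : Nonempty ι := by
      by_contra hn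
      rw [not_nonempty_iff] at hn
      simp at h
    have hk : (0 : ℝ) < Fintype.card ι := by positivity
    rw [infoTerm_eq_sum h]
    calc (0 : ℝ) = ∑ i, (x i - (∑ j, x j) / Fintype.card ι) := by
          rw [Finset.sum_sub_distrib, Finset.sum_const, Finset.card_univ, nsmul_eq_mul]
          field_simp
          ring
      _ ≤ _ := Finset.sum_le_sum fun i _ => sub_le_mul_log_sub (hx i) (div_pos h hk)

/-- An outcome that excludes one of two equally likely values is informative. -/
theorem mul_log_two_le_infoTerm [DecidableEq ι] {x : ι → ℝ} (hx : ∀ i, 0 ≤ x i) {a b : ι}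
    (hab : a ≠ b) (hb : x b = 0) : x a * Real.log 2 ≤ infoTerm x := by
  rcases (hx a).eq_or_lt with ha | ha
  · rw [← ha, zero_mul]
    exact infoTerm_nonneg hx
  have hS : 0 < ∑ i, x i :=
    Finset.sum_pos' (fun i _ => hx i) ⟨a, Finset.mem_univ a, ha⟩
  have : Nonempty ι := ⟨a⟩
  have hk : (0 : ℝ) < Fintype.card ι := by positivity
  rw [infoTerm_eq_sum hS]
  set t := (∑ i, x i) / Fintype.card ι with ht
  have htp : 0 < t := div_pos hS hk
  -- The tangent bounds `x i - t` sum to zero. At `b` the term is 0 instead of `-t`, a gain of `t`;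
  -- at `a` the bound with `2 t` in place of `t` yields an extra `x a * log 2 - t`. The two
  -- corrections by `t` cancel.
  calc x a * Real.log 2
      = ∑ i, (x i - t + ((if i = a then x a * Real.log 2 - t else 0) +
          if i = b then t else 0)) := by
        rw [Finset.sum_add_distrib, Finset.sum_add_distrib, Finset.sum_sub_distrib,
          Finset.sum_const, Finset.card_univ, nsmul_eq_mul, ht, Finset.sum_ite_eq' Finset.univ a,
          Finset.sum_ite_eq' Finset.univ b]
        simp only [Finset.mem_univ, if_true]
        field_simp
        ring
    _ ≤ _ := Finset.sum_le_sum fun i _ => by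
        have h1 := sub_le_mul_log_sub (hx i) htp
        by_cases hia : i = a
        · subst hia
          have h2 := sub_le_mul_log_sub (hx i) (mul_pos two_pos htp)
          rw [Real.log_mul two_ne_zero htp.ne'] at h2
          simp only [if_true, if_neg hab]
          linarith
        · by_cases hib : i = b
          · subst hib
            simp [hia, hb]
          · simpa [hia, hib] using h1

/-- Each `log (x i)` is at most `log (m Q / |ι|)`, and `S log (Q / S) ≤ Q - S` for `S = ∑ x i`. Here
`Q` stands for the probability of the same outcome on a reference state; the error `Q - S` is
harmless since it sums to zero over all outcomes. -/
theorem infoTerm_le [Nonempty ι] {x : ι → ℝ} (hx : ∀ i, 0 ≤ x i) {m Q : ℝ} (hm : 0 < m)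
    (hQ : 0 ≤ Q) (h : ∀ i, x i ≤ m * Q / Fintype.card ι) :
    infoTerm x ≤ (∑ i, x i) * Real.log m + (Q - ∑ i, x i) := by
  have hk : (0 : ℝ) < Fintype.card ι := by positivity
  rcases (Finset.sum_nonneg fun i _ => hx i).eq_or_lt with h0 | hS
  · rw [infoTerm_eq_zero fun i =>
      (Finset.sum_eq_zero_iff_of_nonneg fun i _ => hx i).1 h0.symm i (Finset.mem_univ i), ← h0]
    simpa using hQ
  have hQ : 0 < Q := by
    rcases hQ.eq_or_lt with hq | hq
    · refine absurd hS (not_lt.2 (Finset.sum_nonpos fun i _ => (h i).trans ?_))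
      simp [← hq]
    · exact hq
  have h1 := sub_le_mul_log_sub hS.le hQ
  rw [infoTerm_eq_sum hS]
  calc _ ≤ ∑ i, x i * (Real.log m + Real.log Q - Real.log (∑ j, x j)) :=
        Finset.sum_le_sum fun i _ => by
          rcases (hx i).eq_or_lt with hi | hi
          · simp [← hi]
          · rw [← mul_sub]
            refine mul_le_mul_of_nonneg_left ?_ hi.le
            have h2 := Real.log_le_log hi (h i)
            rw [Real.log_div (by positivity) hk.ne', Real.log_mul hm.ne' hQ.ne'] at h2
            rw [Real.log_div hS.ne' hk.ne']
            linarith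
    _ = (∑ i, x i) * (Real.log m + Real.log Q - Real.log (∑ j, x j)) := by
        rw [Finset.sum_mul]
    _ ≤ _ := by linarith

theorem infoTerm_le_mul_log_card {x : ι → ℝ} (hx : ∀ i, 0 ≤ x i) :
    infoTerm x ≤ (∑ i, x i) * Real.log (Fintype.card ι) := by
  rcases (Finset.sum_nonneg fun i _ => hx i).eq_or_lt with h0 | hS
  · rw [infoTerm_eq_zero fun i =>
      (Finset.sum_eq_zero_iff_of_nonneg fun i _ => hx i).1 h0.symm i (Finset.mem_univ i), ← h0]
    simp
  have : Nonempty ι := by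
    by_contra hn
    rw [not_nonempty_iff] at hn
    simp at hS
  have hk : (0 : ℝ) < Fintype.card ι := by positivity
  have h := infoTerm_le hx hk hS.le fun i => by
    rw [mul_div_assoc, mul_div_cancel₀ _ hk.ne']
    exact Finset.single_le_sum (fun i _ => hx i) (Finset.mem_univ i)
  linarith

/-- Because the terms are nonnegative, finite partial sums bound the information from below.
Summability follows by comparison with `log |ι|` times the outcome probabilities. -/
theorem hasSum_infoTerm {Ω : Type*} [Nonempty ι] {p : ι → Ω → ℝ} (hp : ∀ i y, 0 ≤ p i y)
    (hs : ∀ i, HasSum (p i) (1 / Fintype.card ι)) :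
    HasSum (fun y => infoTerm fun i => p i y) (mutualInformation p) := by
  have hk : (Fintype.card ι : ℝ) ≠ 0 := by positivity
  have hS : HasSum (fun y => ∑ i, p i y) 1 := by
    have := hasSum_sum fun i (_ : i ∈ Finset.univ) => hs i
    simpa [hk] using this
  have hL := hS.mul_right (Real.log (Fintype.card ι))
  have hI : Summable fun y => infoTerm fun i => p i y :=
    Summable.of_nonneg_of_le (fun y => infoTerm_nonneg fun i => hp i y)
      (fun y => infoTerm_le_mul_log_card fun i => hp i y) hL.summable
  have h1 : shannonEntropy (fun v => ∑' y, p v y) = 1 * Real.log (Fintype.card ι) := by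
    simp only [(hs _).tsum_eq, shannonEntropy, Real.negMulLog, Finset.sum_const, Finset.card_univ,
      nsmul_eq_mul, one_div, Real.log_inv]
    field_simp
  have h2 : ∑' y, (∑ v, p v y) * shannonEntropy (fun v => p v y / ∑ w, p w y) =
      1 * Real.log (Fintype.card ι) - ∑' y, infoTerm fun i => p i y := by
    simp only [sum_mul_shannonEntropy fun i => hp i _]
    rw [hL.summable.tsum_sub hI, hL.tsum_eq]
  rw [mutualInformation, h1, h2, sub_sub_cancel]
  exact hI.hasSum

end

/-! ### Protocol information as a function of the states; existence of the minimum. -/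

namespace LOCCInstructions

variable {n : ℕ}

theorem prob_nonneg (T : LOCCInstructions n) (ψ : BipartiteSpace n) (h : List ℕ) :
    0 ≤ T.prob ψ h := by
  unfold prob
  split_ifs <;> positivity

theorem continuous_prob (T : LOCCInstructions n) (h : List ℕ) :
    Continuous fun ψ => T.prob ψ h := by
  unfold prob
  split_ifs
  · refine (Continuous.norm ?_).pow 2
    refine (PiLp.continuous_toLp 2 _).comp ?_
    exact Continuous.matrix_mulVec continuous_const (PiLp.continuous_ofLp 2 _)
  · exact continuous_const

end LOCCInstructions

variable {k n : ℕ}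


theorem hasSum_protocolInformation (hk : 0 < k) {ψ : Fin k → BipartiteSpace n}
    (hψ : Orthonormal ℂ ψ) (P : LOCCProtocol n) :
    HasSum (fun h => infoTerm fun i => 1 / (k : ℝ) * P.prob (ψ i) h)
      (protocolInformation ψ P) := by
  have : Nonempty (Fin k) := ⟨⟨0, hk⟩⟩
  refine hasSum_infoTerm (fun i h => mul_nonneg (by positivity) (P.prob_nonneg _ _)) fun i => ?_
  simpa using (P.terminates (ψ i) (hψ.1 i)).mul_left (1 / (k : ℝ))

theorem hasSum_sum_prob (hk : 0 < k) {ψ : Fin k → BipartiteSpace n}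
    (hψ : Orthonormal ℂ ψ) (P : LOCCProtocol n) :
    HasSum (fun h => ∑ i, 1 / (k : ℝ) * P.prob (ψ i) h) 1 := by
  have := hasSum_sum fun i (_ : i ∈ Finset.univ) =>
    (P.terminates (ψ i) (hψ.1 i)).mul_left (1 / (k : ℝ))
  have hk' : (k : ℝ) ≠ 0 := by positivity
  simpa [hk'] using this

theorem protocolInformation_le_log (hk : 0 < k) {ψ : Fin k → BipartiteSpace n}
    (hψ : Orthonormal ℂ ψ) (P : LOCCProtocol n) : protocolInformation ψ P ≤ Real.log k := by
  have h1 := hasSum_le (fun h => infoTerm_le_mul_log_card fun i : Fin k =>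
      mul_nonneg (by positivity : (0 : ℝ) ≤ 1 / k) (P.prob_nonneg (ψ i) h))
    (hasSum_protocolInformation hk hψ P)
    ((hasSum_sum_prob hk hψ P).mul_right (Real.log (Fintype.card (Fin k))))
  simpa using h1

theorem bddAbove_protocolInformation (hk : 0 < k) {ψ : Fin k → BipartiteSpace n}
    (hψ : Orthonormal ℂ ψ) :
    BddAbove (Set.range fun P : LOCCProtocol n => protocolInformation ψ P) :=
  ⟨Real.log k, by rintro _ ⟨P, rfl⟩; exact protocolInformation_le_log hk hψ P⟩

theorem isCompact_setOf_orthonormal (k : ℕ) (E : Type*) [NormedAddCommGroup E]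
    [InnerProductSpace ℂ E] [FiniteDimensional ℂ E] :
    IsCompact {ψ : Fin k → E | Orthonormal ℂ ψ} := by
  have : ProperSpace E := FiniteDimensional.proper ℂ E
  refine (isCompact_univ_pi fun _ : Fin k => isCompact_closedBall (0 : E) 1).of_isClosed_subset
    ?_ fun ψ hψ i _ => by simp [hψ.1 i]
  simp only [orthonormal_iff_ite, Set.ofPred_forall]
  refine isClosed_iInter fun i => isClosed_iInter fun j => isClosed_eq ?_ continuous_const
  fun_prop

/-- For a fixed protocol the information is the supremum of its finite partial sums, which are
continuous in the states. Suprema of continuous functions are lower semicontinuous, and the supremum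
over protocols preserves this. -/
theorem lowerSemicontinuousOn_loccInformation (hk : 0 < k) [Nonempty (LOCCProtocol n)] :
    LowerSemicontinuousOn (loccInformation : (Fin k → BipartiteSpace n) → ℝ)
      {ψ | Orthonormal ℂ ψ} := by
  intro ψ hψ c hc
  obtain ⟨P, hP⟩ := exists_lt_of_lt_ciSup hc
  obtain ⟨s, hs⟩ := ((hasSum_protocolInformation hk hψ P).eventually (lt_mem_nhds hP)).exists
  have hcont : Continuous fun φ : Fin k → BipartiteSpace n =>
      ∑ h ∈ s, infoTerm fun i => 1 / (k : ℝ) * P.prob (φ i) h :=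
    continuous_finsetSum _ fun h _ => continuous_infoTerm.comp <| continuous_pi fun i =>
      continuous_const.mul ((P.continuous_prob h).comp (continuous_apply i))
  filter_upwards [nhdsWithin_le_nhds (hcont.continuousAt.eventually (lt_mem_nhds hs)),
    self_mem_nhdsWithin] with φ hφ hφo
  refine hφ.trans_le (le_trans ?_ (le_ciSup (bddAbove_protocolInformation hk hφo) P))
  exact sum_le_hasSum s (fun h _ => infoTerm_nonneg fun i =>
    mul_nonneg (by positivity) (P.prob_nonneg _ _)) (hasSum_protocolInformation hk hφo P)

theorem isLeast_worstCaseInformation (hk : 0 < k) [Nonempty (LOCCProtocol n)]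
    (hne : ∃ ψ : Fin k → BipartiteSpace n, Orthonormal ℂ ψ) :
    IsLeast {x : ℝ | ∃ ψ : Fin k → BipartiteSpace n, Orthonormal ℂ ψ ∧ x = loccInformation ψ}
      (worstCaseInformation k n) := by
  obtain ⟨ψ, hψ, hmin⟩ := (lowerSemicontinuousOn_loccInformation (n := n) hk).exists_isMinOn hne
    (isCompact_setOf_orthonormal k _)
  have : Nonempty {ψ : Fin k → BipartiteSpace n // Orthonormal ℂ ψ} := ⟨⟨ψ, hψ⟩⟩
  have hw : worstCaseInformation k n = loccInformation ψ := le_antisymm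
    (ciInf_le (f := fun ψ : {ψ : Fin k → BipartiteSpace n // Orthonormal ℂ ψ} =>
      loccInformation ψ.1) ⟨loccInformation ψ, by rintro _ ⟨φ, rfl⟩; exact hmin φ.2⟩ ⟨ψ, hψ⟩)
    (le_ciInf fun φ => hmin φ.2)
  rw [hw]
  exact ⟨⟨ψ, hψ, rfl⟩, by rintro _ ⟨φ, hφ, rfl⟩; exact hmin hφ⟩

/-! ### Upper bound: generalized Bell states. -/

namespace LOCCInstructions

/-- The total operation of both parties along a history, as a linear map. -/
noncomputable def opLin (T : LOCCInstructions n) (h : List ℕ) :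
    BipartiteSpace n →ₗ[ℂ] EuclideanSpace ℂ (Fin (T.dA h) × Fin (T.dB h)) :=
  Matrix.toLpLin 2 2 (T.opA h ⊗ₖ T.opB h)

theorem prob_of_isRecord (T : LOCCInstructions n) (ψ : BipartiteSpace n) {h : List ℕ}
    (hh : T.IsRecord h) : T.prob ψ h = ‖T.opLin h ψ‖ ^ 2 := by
  rw [prob, if_pos hh]
  rfl

theorem prob_of_not_isRecord (T : LOCCInstructions n) (ψ : BipartiteSpace n) {h : List ℕ}
    (hh : ¬ T.IsRecord h) : T.prob ψ h = 0 := by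
  rw [prob, if_neg hh]

/-- The upper bound uses locality only through this factorization: along a record the total
operation is a tensor product. -/
theorem norm_opLin_single (T : LOCCInstructions n) (h : List ℕ) (r s : Fin n) :
    ‖T.opLin h (EuclideanSpace.single (r, s) 1)‖ =
      ‖WithLp.toLp 2 ((T.opA h).col r)‖ * ‖WithLp.toLp 2 ((T.opB h).col s)‖ := by
  rw [← sq_eq_sq₀ (by positivity) (by positivity), mul_pow, EuclideanSpace.norm_sq_eq,
    EuclideanSpace.norm_sq_eq, EuclideanSpace.norm_sq_eq, Fintype.sum_prod_type,
    Finset.sum_mul_sum]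
  refine Finset.sum_congr rfl fun i _ => Finset.sum_congr rfl fun j _ => ?_
  simp [opLin, Matrix.toLpLin_apply, mul_pow]

end LOCCInstructions

section Bell

variable {m : ℕ} [NeZero m]

/-- The generalized Bell states of `ℂᵐ ⊗ ℂᵐ`, in a bipartite space of possibly larger local
dimension `n`: maximally entangled states indexed by a shift and a phase. -/
noncomputable def bellState (ι : ZMod m → Fin n) (c : ZMod m × ZMod m) : BipartiteSpace n :=
  ∑ i, ((Real.sqrt m : ℂ)⁻¹ * ZMod.stdAddChar (i * c.2)) •
    EuclideanSpace.single (ι i, ι (i + c.1)) (1 : ℂ)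

theorem orthonormal_bellState {ι : ZMod m → Fin n} (hι : Function.Injective ι) :
    Orthonormal ℂ (bellState ι) := by
  rw [orthonormal_iff_ite]
  rintro ⟨a, b⟩ ⟨a', b'⟩
  have hs : ((Real.sqrt m : ℂ)⁻¹) * ((Real.sqrt m : ℂ)⁻¹) = (m : ℂ)⁻¹ := by
    rw [← mul_inv, ← Complex.ofReal_mul, Real.mul_self_sqrt (Nat.cast_nonneg m),
      Complex.ofReal_natCast]
  have hm : (m : ℂ) ≠ 0 := NeZero.ne _
  have key : ∀ i : ZMod m, (inner ℂ (((Real.sqrt m : ℂ)⁻¹ * ZMod.stdAddChar (i * b)) •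
      EuclideanSpace.single (ι i, ι (i + a)) (1 : ℂ)) (bellState ι (a', b')) : ℂ) =
      if a = a' then (m : ℂ)⁻¹ * ZMod.stdAddChar (i * (b' - b)) else 0 := by
    intro i
    have h1 : (ZMod.stdAddChar (i * (b' - b)) : ℂ) =
        (starRingEnd ℂ) (ZMod.stdAddChar (i * b)) * ZMod.stdAddChar (i * b') := by
      rw [← AddChar.map_neg_eq_conj, ← AddChar.map_add_eq_mul]
      ring_nf
    simp only [bellState, inner_sum, inner_smul_left, inner_smul_right,
      EuclideanSpace.inner_single_left, map_mul, map_inv₀, Complex.conj_ofReal, map_one, one_mul,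
      PiLp.single_apply, Prod.mk.injEq, hι.eq_iff]
    rw [Finset.sum_eq_single i]
    · simp only [true_and, add_right_inj]
      split_ifs
      · rw [h1, ← hs]
        ring
      · simp
    · intro j _ hj
      simp [Ne.symm hj]
    · simp
  rw [bellState, sum_inner, Finset.sum_congr rfl fun i _ => key i]
  by_cases ha : a = a'
  · simp only [ha, if_true, ← Finset.mul_sum, Prod.mk.injEq, true_and]
    -- Orthogonality of characters: the sum over `i` is `m` if `b = b'` and 0 otherwise.
    rw [AddChar.sum_mulShift _ (ZMod.isPrimitive_stdAddChar m), ZMod.card]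
    by_cases hb : b = b'
    · simp [hb, hm]
    · simp [hb, sub_eq_zero, Ne.symm hb]
  · simp [ha]

/-- On a generalized Bell state no product operation is much likelier to succeed than on the
maximally mixed state. -/
theorem prob_bellState_le (T : LOCCInstructions n) (ι : ZMod m → Fin n) (c : ZMod m × ZMod m)
    (h : List ℕ) : T.prob (bellState ι c) h ≤
      m * (((m : ℝ) ^ 2)⁻¹ * ∑ d : ZMod m × ZMod m,
        T.prob (EuclideanSpace.single (ι d.1, ι d.2) 1) h) := by
  have hm : (0 : ℝ) < m := Nat.cast_pos.2 (NeZero.pos m)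
  by_cases hh : T.IsRecord h
  · simp only [T.prob_of_isRecord _ hh, T.norm_opLin_single]
    set α : ZMod m → ℝ := fun i => ‖WithLp.toLp 2 ((T.opA h).col (ι i))‖
    set β : ZMod m → ℝ := fun i => ‖WithLp.toLp 2 ((T.opB h).col (ι i))‖
    -- The phases have modulus 1 and disappear in the triangle inequality. The shift `c.1` only
    -- permutes the `β i`, so after Cauchy–Schwarz the bound no longer depends on `c`.
    have h1 : ‖T.opLin h (bellState ι c)‖ ≤ (Real.sqrt m)⁻¹ * ∑ i, α i * β (i + c.1) := by
      rw [bellState, map_sum, Finset.mul_sum]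
      refine (norm_sum_le _ _).trans (Finset.sum_le_sum fun i _ => ?_)
      rw [map_smul, norm_smul, T.norm_opLin_single, norm_mul, AddChar.norm_apply, norm_inv,
        Complex.norm_real, Real.norm_of_nonneg (Real.sqrt_nonneg _), mul_one]
    have h2 : (∑ i, α i * β (i + c.1)) ^ 2 ≤ (∑ i, α i ^ 2) * ∑ i, β i ^ 2 := by
      refine (Finset.sum_mul_sq_le_sq_mul_sq _ _ _).trans_eq ?_
      exact congrArg (_ * ·) (Equiv.sum_comp (Equiv.addRight c.1) fun i => β i ^ 2)
    have h3 : ∑ d : ZMod m × ZMod m, (α d.1 * β d.2) ^ 2 =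
        (∑ i, α i ^ 2) * ∑ i, β i ^ 2 := by
      simp only [Fintype.sum_prod_type, mul_pow, Finset.sum_mul_sum]
    change _ ≤ m * (((m : ℝ) ^ 2)⁻¹ * ∑ d : ZMod m × ZMod m, (α d.1 * β d.2) ^ 2)
    calc _ ≤ ((Real.sqrt m)⁻¹ * ∑ i, α i * β (i + c.1)) ^ 2 :=
          pow_le_pow_left₀ (norm_nonneg _) h1 2
      _ = (m : ℝ)⁻¹ * (∑ i, α i * β (i + c.1)) ^ 2 := by
          rw [mul_pow, inv_pow, Real.sq_sqrt hm.le]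
      _ ≤ (m : ℝ)⁻¹ * ((∑ i, α i ^ 2) * ∑ i, β i ^ 2) :=
          mul_le_mul_of_nonneg_left h2 (by positivity)
      _ = _ := by
          rw [h3]
          field_simp
  · simp [T.prob_of_not_isRecord _ hh]

/-- `infoTerm_le` is applied to each record with `Q` its average probability over the `m²` product
basis vectors. By termination both `Q` and the ensemble probability have total 1. -/
theorem protocolInformation_bellState_le (hk : 0 < k) {ι : ZMod m → Fin n}
    (hι : Function.Injective ι) {f : Fin k → ZMod m × ZMod m} (hf : Function.Injective f)
    (P : LOCCProtocol n) :
    protocolInformation (fun i => bellState ι (f i)) P ≤ Real.log m := by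
  have hm : (0 : ℝ) < m := Nat.cast_pos.2 (NeZero.pos m)
  have hk' : (0 : ℝ) < k := Nat.cast_pos.2 hk
  have : Nonempty (Fin k) := ⟨⟨0, hk⟩⟩
  have hψ : Orthonormal ℂ fun i => bellState ι (f i) := (orthonormal_bellState hι).comp f hf
  have hQ : HasSum (fun h => ((m : ℝ) ^ 2)⁻¹ * ∑ d : ZMod m × ZMod m,
      P.prob (EuclideanSpace.single (ι d.1, ι d.2) 1) h) 1 := by
    have := (hasSum_sum fun (d : ZMod m × ZMod m) (_ : d ∈ Finset.univ) =>
      P.terminates (EuclideanSpace.single (ι d.1, ι d.2) 1) (by simp)).mul_left ((m : ℝ) ^ 2)⁻¹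
    have hc : ((m : ℝ) ^ 2)⁻¹ * ∑ _d : ZMod m × ZMod m, (1 : ℝ) = 1 := by
      simp [ZMod.card]
      field_simp
    rwa [hc] at this
  have hS := hasSum_sum_prob hk hψ P
  have h1 := hasSum_le (fun h => infoTerm_le (fun i : Fin k =>
      mul_nonneg (by positivity : (0 : ℝ) ≤ 1 / k) (P.prob_nonneg (bellState ι (f i)) h)) hm
      (mul_nonneg (by positivity) (Finset.sum_nonneg fun d _ => P.prob_nonneg _ h)) fun i => by
        rw [Fintype.card_fin, one_div, inv_mul_eq_div]
        exact div_le_div_of_nonneg_right (prob_bellState_le _ ι (f i) h) hk'.le)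
    (hasSum_protocolInformation hk hψ P) ((hS.mul_right (Real.log m)).add (hQ.sub hS))
  simpa using h1

end Bell

/-- For `m = ⌈√k⌉`, the bound `k ≤ n ^ 2` gives `m ≤ n`, so `ℂᵐ` embeds in each local space, and `k
≤ m * m` ensures enough Bell states. -/
theorem exists_orthonormal_protocolInformation_le (hk : 0 < k) (hkn : k ≤ n ^ 2) :
    ∃ ψ : Fin k → BipartiteSpace n, Orthonormal ℂ ψ ∧
      ∀ P : LOCCProtocol n, protocolInformation ψ P ≤ Real.log (⌈Real.sqrt (k : ℝ)⌉₊ : ℝ) := by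
  set m := ⌈Real.sqrt (k : ℝ)⌉₊ with hmdef
  have hm : 0 < m := Nat.ceil_pos.2 (Real.sqrt_pos.2 (Nat.cast_pos.2 hk))
  have : NeZero m := ⟨hm.ne'⟩
  have hmn : m ≤ n := Nat.ceil_le.2 (Real.sqrt_le_iff.2 ⟨by positivity, by exact_mod_cast hkn⟩)
  have hkm : k ≤ m * m := by
    have h := (Real.sqrt_le_left (Nat.cast_nonneg m)).1 (Nat.le_ceil (Real.sqrt (k : ℝ)))
    rw [← sq]
    exact_mod_cast h
  obtain ⟨ι⟩ := Function.Embedding.nonempty_of_card_le (α := ZMod m) (β := Fin n)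
    (by simpa [ZMod.card] using hmn)
  obtain ⟨f⟩ := Function.Embedding.nonempty_of_card_le (α := Fin k) (β := ZMod m × ZMod m)
    (by simpa [ZMod.card] using hkm)
  exact ⟨fun i => bellState ι (f i), (orthonormal_bellState ι.injective).comp f f.injective,
    protocolInformation_bellState_le hk ι.injective f.injective⟩

/-! ### Orthonormal families on which a trace-zero operator has zero diagonal. -/

section ZeroDiagonal

variable {E : Type*} [NormedAddCommGroup E] [InnerProductSpace ℂ E]

theorem exists_sq_add_sq_eq_one_and_add_eq_zero (A B : ℝ) :
    ∃ x y : ℝ, x ^ 2 + y ^ 2 = 1 ∧ A * x + B * y = 0 := by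
  by_cases h : A ^ 2 + B ^ 2 = 0
  · have hA : A = 0 := by nlinarith [sq_nonneg A, sq_nonneg B]
    have hB : B = 0 := by nlinarith [sq_nonneg A, sq_nonneg B]
    exact ⟨1, 0, by simp, by simp [hA, hB]⟩
  · have hp : 0 < A ^ 2 + B ^ 2 := lt_of_le_of_ne (by positivity) (Ne.symm h)
    refine ⟨-B / Real.sqrt (A ^ 2 + B ^ 2), A / Real.sqrt (A ^ 2 + B ^ 2), ?_, ?_⟩
    · rw [div_pow, div_pow, Real.sq_sqrt hp.le]
      field_simp
      ring
    · ring

/-- Two complex numbers `z ≠ 0`, `X(w) = w α + conj w β` can be made parallel. -/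
theorem exists_unit_parallel (α β : ℂ) {z : ℂ} (hz : z ≠ 0) :
    ∃ (w : ℂ) (t : ℝ), (starRingEnd ℂ) w * w = 1 ∧ w * α + (starRingEnd ℂ) w * β = t * z := by
  -- With `w = x + i y`, the imaginary part of `conj z * X(w)` is a real linear form in `(x, y)`, so
  -- it vanishes at some unit vector.
  obtain ⟨x, y, hxy, h⟩ := exists_sq_add_sq_eq_one_and_add_eq_zero
    (((starRingEnd ℂ) z * (α + β)).im) (((starRingEnd ℂ) z * (Complex.I * (α - β))).im)
  set w : ℂ := x + y * Complex.I with hw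
  have hwc : (starRingEnd ℂ) w = x - y * Complex.I := by simp [hw, sub_eq_add_neg]
  set X := w * α + (starRingEnd ℂ) w * β with hX
  have him : ((starRingEnd ℂ) z * X).im = 0 := by
    rw [← h]
    have : (starRingEnd ℂ) z * X = x * ((starRingEnd ℂ) z * (α + β)) +
        y * ((starRingEnd ℂ) z * (Complex.I * (α - β))) := by
      rw [hX, hwc, hw]
      ring
    rw [this, Complex.add_im, Complex.im_ofReal_mul, Complex.im_ofReal_mul]
    ring
  refine ⟨w, ((starRingEnd ℂ) z * X).re / Complex.normSq z, ?_, ?_⟩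
  · rw [hwc, hw]
    have : ((x : ℂ) - y * Complex.I) * (x + y * Complex.I) = ((x ^ 2 + y ^ 2 : ℝ) : ℂ) := by
      push_cast
      linear_combination -(y : ℂ) ^ 2 * Complex.I_sq
    rw [this, hxy, Complex.ofReal_one]
  · have h1 : ((((starRingEnd ℂ) z * X).re : ℝ) : ℂ) = (starRingEnd ℂ) z * X :=
      Complex.ext (by simp) (by simp only [Complex.ofReal_im, him])
    have h2 : (Complex.normSq z : ℂ) ≠ 0 := by
      exact_mod_cast (Complex.normSq_pos.2 hz).ne'
    rw [Complex.ofReal_div, h1, div_mul_eq_mul_div, eq_div_iff h2, Complex.normSq_eq_conj_mul_self]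
    ring

/-- With `c = cos θ`, `s = sin θ` the expression goes from 1 at `θ = 0` to -1 at `θ = π / 2`. -/
theorem exists_rotation (t : ℝ) :
    ∃ c s : ℝ, c ^ 2 + s ^ 2 = 1 ∧ c ^ 2 - s ^ 2 + t * (c * s) = 0 := by
  have hc : ContinuousOn (fun θ : ℝ => Real.cos θ ^ 2 - Real.sin θ ^ 2 +
      t * (Real.cos θ * Real.sin θ)) (Set.Icc 0 (Real.pi / 2)) := by fun_prop
  obtain ⟨θ, -, hθ⟩ := intermediate_value_Icc' (by positivity) hc
    (show (0 : ℝ) ∈ Set.Icc _ _ by simp)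
  exact ⟨Real.cos θ, Real.sin θ, by rw [add_comm]; exact Real.sin_sq_add_cos_sq θ, hθ⟩

/-- In the span of two orthonormal vectors with distinct diagonal entries there is a rotated pair
whose diagonal entries both equal the average. -/
theorem exists_equalizing_rotation (T : E →ₗ[ℂ] E) {u v : E} (hu : inner ℂ u u = (1 : ℂ))
    (hv : inner ℂ v v = (1 : ℂ)) (huv : inner ℂ u v = (0 : ℂ))
    (hne : (inner ℂ u (T u) : ℂ) ≠ inner ℂ v (T v)) :
    ∃ p q r s : ℂ, inner ℂ (p • u + q • v) (p • u + q • v) = (1 : ℂ) ∧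
      inner ℂ (r • u + s • v) (r • u + s • v) = (1 : ℂ) ∧
      inner ℂ (p • u + q • v) (r • u + s • v) = (0 : ℂ) ∧
      (inner ℂ (p • u + q • v) (T (p • u + q • v)) : ℂ) =
        (inner ℂ u (T u) + inner ℂ v (T v)) / 2 ∧
      (inner ℂ (r • u + s • v) (T (r • u + s • v)) : ℂ) =
        (inner ℂ u (T u) + inner ℂ v (T v)) / 2 := by
  have hvu : inner ℂ v u = (0 : ℂ) := by rw [← inner_conj_symm, huv, map_zero]
  set a : ℂ := inner ℂ u (T u) with ha
  set d : ℂ := inner ℂ v (T v) with hd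
  set α : ℂ := inner ℂ u (T v) with hα
  set β : ℂ := inner ℂ v (T u) with hβ
  -- The phase `w` makes the cross term of `c u + w s v` equal to `c s t (a - d)` with `t` real. The
  -- deviation of its diagonal entry from `(a + d) / 2` is then `(a - d) / 2` times the real number
  -- `c² - s² + 2 t c s`, which a rotation annihilates.
  obtain ⟨w, t, hw, ht⟩ := exists_unit_parallel α β (sub_ne_zero.2 hne)
  obtain ⟨c, s, hcs, h0⟩ := exists_rotation (2 * t)
  have hcs' : (c : ℂ) ^ 2 + (s : ℂ) ^ 2 = 1 := by exact_mod_cast hcs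
  have h0' : (c : ℂ) ^ 2 - (s : ℂ) ^ 2 + 2 * t * (c * s) = 0 := by exact_mod_cast h0
  refine ⟨c, w * s, -((starRingEnd ℂ) w * s), c, ?_, ?_, ?_, ?_, ?_⟩ <;>
    simp only [map_add, map_smul, inner_add_left, inner_add_right, inner_smul_left,
      inner_smul_right, hu, hv, huv, hvu, map_mul, map_neg, Complex.conj_ofReal,
      Complex.conj_conj, ← ha, ← hd, ← hα, ← hβ]
  · linear_combination hcs' + (s : ℂ) ^ 2 * hw
  · linear_combination hcs' + (s : ℂ) ^ 2 * hw
  · ring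
  · linear_combination (s : ℂ) ^ 2 * d * hw + c * s * ht + (a - d) / 2 * h0' + (a + d) / 2 * hcs'
  · linear_combination (s : ℂ) ^ 2 * a * hw - c * s * ht - (a - d) / 2 * h0' + (a + d) / 2 * hcs'

end ZeroDiagonal

/-- An orthonormal family on which `T` has trace zero can be replaced by one on which all the
diagonal entries of `T` vanish. -/
theorem exists_orthonormal_forall_inner_eq_zero {E : Type*} [NormedAddCommGroup E]
    [InnerProductSpace ℂ E] [FiniteDimensional ℂ E] (T : E →ₗ[ℂ] E) {r : ℕ} {e : Fin r → E}
    (he : Orthonormal ℂ e) (h0 : ∑ i, (inner ℂ (e i) (T (e i)) : ℂ) = 0) :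
    ∃ b : Fin r → E, Orthonormal ℂ b ∧ ∀ i, (inner ℂ (b i) (T (b i)) : ℂ) = 0 := by
  have hT : Continuous T := T.continuous_of_finiteDimensional
  have hcont : ∀ i : Fin r, Continuous fun b : Fin r → E => (inner ℂ (b i) (T (b i)) : ℂ) :=
    fun i => (continuous_apply i).inner (hT.comp (continuous_apply i))
  have hK : IsCompact ({b : Fin r → E | Orthonormal ℂ b} ∩
      {b | ∑ i, (inner ℂ (b i) (T (b i)) : ℂ) = 0}) :=
    (isCompact_setOf_orthonormal r E).inter_right
      (isClosed_eq (continuous_finsetSum _ fun i _ => hcont i) continuous_const)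
  -- A minimizer of the sum of squared moduli of the diagonal entries has zero diagonal. Otherwise,
  -- since the entries sum to zero, two of them, `a` and `d`, differ; replacing both by their
  -- average keeps the sum and lowers the objective by `|a - d|² / 2`.
  obtain ⟨b, ⟨hb, hb0⟩, hmin⟩ := hK.exists_isMinOn ⟨e, he, h0⟩
    (f := fun b : Fin r → E => ∑ i, ‖(inner ℂ (b i) (T (b i)) : ℂ)‖ ^ 2)
    (continuous_finsetSum _ fun i _ => (hcont i).norm.pow 2).continuousOn
  refine ⟨b, hb, ?_⟩
  by_contra! hi
  obtain ⟨i, hi⟩ := hi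
  obtain ⟨j, hj⟩ : ∃ j, (inner ℂ (b i) (T (b i)) : ℂ) ≠ inner ℂ (b j) (T (b j)) := by
    by_contra! hall
    have hb0' : ∑ j, (inner ℂ (b j) (T (b j)) : ℂ) = 0 := hb0
    rw [Finset.sum_congr rfl fun j _ => (hall j).symm, Finset.sum_const, Finset.card_univ,
      Fintype.card_fin, nsmul_eq_mul] at hb0'
    have hr : (r : ℂ) ≠ 0 := Nat.cast_ne_zero.2 (Fin.pos i).ne'
    exact (mul_ne_zero hr hi) hb0'
  have hij : i ≠ j := fun h => hj (by rw [h])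
  have hbo := orthonormal_iff_ite.1 hb
  obtain ⟨p, q, s, t, hpp, hss, hps, hpT, hsT⟩ := exists_equalizing_rotation T
    (by simpa using hbo i i) (by simpa using hbo j j) (by simpa [hij] using hbo i j) hj
  have hsp : (inner ℂ (s • b i + t • b j) (p • b i + q • b j) : ℂ) = 0 := by
    rw [← inner_conj_symm, hps, map_zero]
  set b' : Fin r → E := fun l =>
    if l = i then p • b i + q • b j else if l = j then s • b i + t • b j else b l with hb'
  have hbi : b' i = p • b i + q • b j := by simp [hb']
  have hbj : b' j = s • b i + t • b j := by simp [hb', hij.symm]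
  have hbl : ∀ l, l ≠ i ∧ l ≠ j → b' l = b l := fun l hl => by simp [hb', hl.1, hl.2]
  have hl1 : ∀ l, l ≠ i ∧ l ≠ j → ∀ x y : ℂ, (inner ℂ (b l) (x • b i + y • b j) : ℂ) = 0 :=
    fun l hl x y => by
      rw [inner_add_right, inner_smul_right, inner_smul_right, hbo, hbo, if_neg hl.1, if_neg hl.2,
        mul_zero, mul_zero, add_zero]
  have hl2 : ∀ l, l ≠ i ∧ l ≠ j → ∀ x y : ℂ, (inner ℂ (x • b i + y • b j) (b l) : ℂ) = 0 :=
    fun l hl x y => by rw [← inner_conj_symm, hl1 l hl, map_zero]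
  have hortho : Orthonormal ℂ b' := by
    have hcases : ∀ l, l = i ∨ l = j ∨ (l ≠ i ∧ l ≠ j) := fun l => by tauto
    rw [orthonormal_iff_ite]
    intro l l'
    rcases hcases l with rfl | rfl | hl <;> rcases hcases l' with rfl | rfl | hl'
    · rw [hbi, hpp, if_pos rfl]
    · simp [hbi, hbj, hps, hij]
    · simp [hbi, hbl _ hl', hl2 _ hl', hl'.1.symm]
    · simp [hbi, hbj, hsp, hij.symm]
    · rw [hbj, hss, if_pos rfl]
    · simp [hbj, hbl _ hl', hl2 _ hl', hl'.2.symm]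
    · simp [hbi, hbl _ hl, hl1 _ hl, hl.1]
    · simp [hbj, hbl _ hl, hl1 _ hl, hl.2]
    · rw [hbl _ hl, hbl _ hl', hbo]
  have hsum : ∑ l, (inner ℂ (b' l) (T (b' l)) : ℂ) = 0 := by
    have h1 := Fintype.sum_eq_add (f := fun l =>
      (inner ℂ (b' l) (T (b' l)) : ℂ) - inner ℂ (b l) (T (b l))) i j hij
      fun l hl => by simp [hbl l hl]
    rw [Finset.sum_sub_distrib, hb0, sub_zero, hbi, hbj, hpT, hsT] at h1
    rw [h1]
    ring
  have hF := Fintype.sum_eq_add (f := fun l =>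
      ‖(inner ℂ (b' l) (T (b' l)) : ℂ)‖ ^ 2 - ‖(inner ℂ (b l) (T (b l)) : ℂ)‖ ^ 2) i j hij
      fun l hl => by simp [hbl l hl]
  have hle := isMinOn_iff.1 hmin b' ⟨hortho, hsum⟩
  rw [Finset.sum_sub_distrib, hbi, hbj, hpT, hsT, norm_div, Complex.norm_two] at hF
  have hpar := parallelogram_law_with_norm ℝ (inner ℂ (b i) (T (b i)) : ℂ)
    (inner ℂ (b j) (T (b j)))
  have hpos : 0 < ‖(inner ℂ (b i) (T (b i)) : ℂ) - inner ℂ (b j) (T (b j))‖ :=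
    norm_pos_iff.2 (sub_ne_zero.2 hj)
  nlinarith

/-! ### Perfect discrimination of two orthogonal states by a one-way protocol. -/

open scoped ComplexOrder in
/-- A projective measurement annihilating one of two orthogonal vectors on each outcome. -/
theorem exists_projection {x y : Fin n → ℂ} (hxy : star y ⬝ᵥ x = 0) :
    ∃ P : Matrix (Fin n) (Fin n) ℂ, Pᴴ * P + (1 - P)ᴴ * (1 - P) = 1 ∧
      P *ᵥ x = 0 ∧ (1 - P) *ᵥ y = 0 := by
  by_cases hy : y = 0
  · exact ⟨0, by simp, by simp, by simp [hy]⟩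
  have hyy : star y ⬝ᵥ y ≠ 0 := fun h => hy (dotProduct_star_self_eq_zero.1 h)
  set P : Matrix (Fin n) (Fin n) ℂ := (star y ⬝ᵥ y)⁻¹ • Matrix.vecMulVec y (star y) with hP
  have hPv : ∀ z, P *ᵥ z = ((star y ⬝ᵥ y)⁻¹ * (star y ⬝ᵥ z)) • y := fun z => by
    ext i
    simp [hP, Matrix.smul_mulVec, Matrix.vecMulVec_mulVec]
    ring
  have hreal : star (star y ⬝ᵥ y) = star y ⬝ᵥ y := (Matrix.star_dotProduct y y).symm
  have hPH : Pᴴ = P := by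
    rw [hP, Matrix.conjTranspose_smul, Matrix.conjTranspose_vecMulVec, star_star, star_inv₀, hreal]
  have hPP : P * P = P := by
    rw [hP, Matrix.smul_mul, Matrix.mul_smul, Matrix.vecMulVec_mul_vecMulVec, Matrix.vecMulVec_smul,
      smul_smul, smul_smul, mul_assoc, inv_mul_cancel₀ hyy, mul_one]
  refine ⟨P, ?_, ?_, ?_⟩
  · rw [Matrix.conjTranspose_sub, Matrix.conjTranspose_one, hPH, hPP, sub_mul, mul_sub, mul_sub, hPP]
    simp
  · rw [hPv, hxy, mul_zero, zero_smul]
  · rw [Matrix.sub_mulVec, Matrix.one_mulVec, hPv, inv_mul_cancel₀ hyy, one_smul, sub_self]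

theorem norm_sq_toLp_mulVec {ι κ : Type*} [Fintype ι] [Fintype κ] (X : Matrix ι κ ℂ)
    (v : κ → ℂ) :
    ((‖WithLp.toLp 2 (X *ᵥ v)‖ ^ 2 : ℝ) : ℂ) = star v ⬝ᵥ ((Xᴴ * X) *ᵥ v) := by
  have h := inner_self_eq_norm_sq_to_K (𝕜 := ℂ) (WithLp.toLp 2 (X *ᵥ v))
  rw [EuclideanSpace.inner_eq_star_dotProduct] at h
  push_cast
  refine h.symm.trans ?_
  rw [dotProduct_comm, Matrix.star_mulVec, ← Matrix.dotProduct_mulVec, Matrix.mulVec_mulVec]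

/-- Measurement operators satisfying the completeness relation preserve the total probability. -/
theorem sum_norm_sq_toLp_mulVec {ι κ σ : Type*} [Fintype ι] [Fintype κ] [DecidableEq κ]
    (s : Finset σ) (X : σ → Matrix ι κ ℂ) (hX : ∑ a ∈ s, (X a)ᴴ * X a = 1)
    (v : EuclideanSpace ℂ κ) :
    ∑ a ∈ s, ‖WithLp.toLp 2 (X a *ᵥ WithLp.ofLp v)‖ ^ 2 = ‖v‖ ^ 2 := by
  have h1 := norm_sq_toLp_mulVec (1 : Matrix κ κ ℂ) (WithLp.ofLp v)
  rw [Matrix.one_mulVec, Matrix.conjTranspose_one, Matrix.one_mul] at h1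
  apply Complex.ofReal_injective
  change _ = ((‖WithLp.toLp 2 (WithLp.ofLp v)‖ ^ 2 : ℝ) : ℂ)
  rw [h1, Complex.ofReal_sum]
  simp only [norm_sq_toLp_mulVec]
  rw [← dotProduct_sum, ← Matrix.sum_mulVec, hX]

namespace LOCCInstructions

/-- Alice measures with the operators `K j`, `j < N`; then Bob measures with the two operators
`M j 0`, `M j 1`, which depend on Alice's outcome. -/
def oneWay (N : ℕ) (K : ℕ → Matrix (Fin n) (Fin n) ℂ) (M : ℕ → ℕ → Matrix (Fin n) (Fin n) ℂ)
    (hK : ∑ j ∈ Finset.range N, (K j)ᴴ * K j = 1)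
    (hM : ∀ j, ∑ c ∈ Finset.range 2, (M j c)ᴴ * M j c = 1) : LOCCInstructions n where
  dA _ := n
  dB _ := n
  initA := 1
  initB := 1
  move
    | [] => .alice
    | [_] => .bob
    | _ => .halt
  outcomes
    | [] => N
    | _ => 2
  KA h j := match h with
    | [] => K j
    | _ => 1
  KB h j := match h with
    | [i] => M i j
    | _ => 1
  initA_isometry := by simp
  initB_isometry := by simp
  alice_measures := by
    rintro (_ | ⟨i, _ | ⟨i', h⟩⟩) hm
    · exact ⟨hK, fun _ _ => by simp⟩
    · cases hm
    · cases hm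
  bob_measures := by
    rintro (_ | ⟨i, _ | ⟨i', h⟩⟩) hm
    · cases hm
    · exact ⟨hM i, fun _ _ => by simp⟩
    · cases hm

section oneWay

variable {N : ℕ} {K : ℕ → Matrix (Fin n) (Fin n) ℂ} {M : ℕ → ℕ → Matrix (Fin n) (Fin n) ℂ}
  {hK : ∑ j ∈ Finset.range N, (K j)ᴴ * K j = 1}
  {hM : ∀ j, ∑ c ∈ Finset.range 2, (M j c)ᴴ * M j c = 1}

theorem isRecord_oneWay {h : List ℕ} :
    (oneWay N K M hK hM).IsRecord h ↔ ∃ j < N, ∃ c < 2, h = [c, j] := by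
  constructor
  · rintro ⟨hr, hm⟩
    match h, hr, hm with
    | [], _, hm => cases hm
    | [_], _, hm => cases hm
    | [c, j], hr, _ => exact ⟨j, hr.1.2.2, c, hr.2.2, rfl⟩
    | _ :: _ :: _ :: _, hr, _ => exact absurd rfl hr.2.1
  · rintro ⟨j, hj, c, hc, rfl⟩
    exact ⟨⟨⟨trivial, by simp [oneWay], hj⟩, by simp [oneWay], hc⟩, rfl⟩

theorem prob_oneWay (ψ : BipartiteSpace n) {j c : ℕ} (hj : j < N) (hc : c < 2) :
    (oneWay N K M hK hM).prob ψ [c, j] =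
      ‖WithLp.toLp 2 ((K j ⊗ₖ M j c) *ᵥ WithLp.ofLp ψ)‖ ^ 2 := by
  rw [prob, if_pos (isRecord_oneWay.2 ⟨j, hj, c, hc, rfl⟩)]
  have key : ∀ A B : Matrix (Fin n) (Fin n) ℂ, A = K j → B = M j c →
      ‖WithLp.toLp 2 ((A ⊗ₖ B) *ᵥ WithLp.ofLp ψ)‖ ^ 2 =
        ‖WithLp.toLp 2 ((K j ⊗ₖ M j c) *ᵥ WithLp.ofLp ψ)‖ ^ 2 := by
    rintro A B rfl rfl
    rfl
  -- These are the total operators along `[c, j]`: each party begins with the identity isometry and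
  -- applies the identity during the other's turn.
  have h := key (1 * (K j * 1)) (M j c * (1 * 1)) (by simp) (by simp)
  exact h

theorem hasSum_prob_oneWay (ψ : BipartiteSpace n) :
    HasSum (fun h => (oneWay N K M hK hM).prob ψ h) (‖ψ‖ ^ 2) := by
  set f : ℕ × ℕ → List ℕ := fun a => [a.2, a.1] with hf
  have hinj : Function.Injective f := fun a b hab => by
    simp only [hf, List.cons.injEq, and_true] at hab
    exact Prod.ext hab.2 hab.1
  have h1 : HasSum (fun h => (oneWay N K M hK hM).prob ψ h) _ := hasSum_sum_of_ne_finset_zero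
    (s := (Finset.range N ×ˢ Finset.range 2).image f) fun h hh => by
      rw [prob, if_neg]
      rintro hr
      obtain ⟨j, hj, c, hc, rfl⟩ := isRecord_oneWay.1 hr
      exact hh (Finset.mem_image.2 ⟨(j, c), by simp [hj, hc], rfl⟩)
  rw [Finset.sum_image hinj.injOn] at h1
  convert h1 using 1
  rw [← sum_norm_sq_toLp_mulVec (Finset.range N ×ˢ Finset.range 2)
    (fun a => K a.1 ⊗ₖ M a.1 a.2) ?_ ψ]
  · refine Finset.sum_congr rfl fun a ha => ?_
    rw [Finset.mem_product, Finset.mem_range, Finset.mem_range] at ha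
    exact (prob_oneWay ψ ha.1 ha.2).symm
  · simp only [Matrix.conjTranspose_kronecker, ← Matrix.mul_kronecker_mul]
    rw [Finset.sum_product]
    -- Bob's operators depend on `j`, so they are summed out first, for each fixed `j`.
    have hB : ∀ j, ∑ c ∈ Finset.range 2, ((K j)ᴴ * K j) ⊗ₖ ((M j c)ᴴ * M j c) =
        ((K j)ᴴ * K j) ⊗ₖ (1 : Matrix (Fin n) (Fin n) ℂ) := fun j => by
      rw [← hM j]
      exact (map_sum (Matrix.kroneckerMapBilinear (LinearMap.mul ℂ ℂ) ((K j)ᴴ * K j)) _ _).symm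
    simp only [hB]
    refine (map_sum ((Matrix.kroneckerMapBilinear (l := Fin n) (m := Fin n)
      (LinearMap.mul ℂ ℂ)).flip (1 : Matrix (Fin n) (Fin n) ℂ)) _ _).symm.trans ?_
    rw [hK]
    exact Matrix.one_kronecker_one

end oneWay

end LOCCInstructions

/-- The unnormalized state of Bob's system after Alice's outcome `b`. -/
def conditionalState (b : Fin n → ℂ) (ψ : BipartiteSpace n) (l : Fin n) : ℂ :=
  ∑ i, star (b i) * ψ (i, l)

/-- The operator `|b⟩⟨b| ⊗ M` sends `ψ` to `b` tensored with the image under `M` of Bob's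
conditional state. -/
theorem kronecker_mulVec_eq_zero {b : Fin n → ℂ} {M : Matrix (Fin n) (Fin n) ℂ}
    {ψ : BipartiteSpace n} (h : M *ᵥ conditionalState b ψ = 0) :
    (Matrix.vecMulVec b (star b) ⊗ₖ M) *ᵥ WithLp.ofLp ψ = 0 := by
  ext ⟨i, l⟩
  have h1 : b i * (M *ᵥ conditionalState b ψ) l = 0 := by rw [h, Pi.zero_apply, mul_zero]
  rw [Pi.zero_apply, ← h1]
  simp only [Matrix.mulVec, dotProduct, Matrix.kroneckerMap_apply, Matrix.vecMulVec_apply,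
    Fintype.sum_prod_type, conditionalState, Finset.mul_sum, Pi.star_apply]
  rw [Finset.sum_comm]
  exact Finset.sum_congr rfl fun _ _ => Finset.sum_congr rfl fun _ _ => by ring

/-- For two orthogonal states Alice has a basis on each of whose outcomes Bob is left with
orthogonal states. -/
theorem exists_orthonormal_conditionalState {φ ψ : BipartiteSpace n}
    (h : (inner ℂ φ ψ : ℂ) = 0) :
    ∃ b : Fin n → EuclideanSpace ℂ (Fin n), Orthonormal ℂ b ∧
      ∀ j, star (conditionalState (b j) φ) ⬝ᵥ conditionalState (b j) ψ = 0 := by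
  -- `G` is the partial trace of `|ψ⟩⟨φ|` over Bob. Its diagonal entry at `b` is the overlap of
  -- Bob's two conditional states, and its trace is `⟨φ, ψ⟩ = 0`.
  set G : Matrix (Fin n) (Fin n) ℂ :=
    Matrix.of fun i i' => ∑ l, ψ (i, l) * star (φ (i', l)) with hG
  have hT : ∀ b : EuclideanSpace ℂ (Fin n), (inner ℂ b (Matrix.toLpLin 2 2 G b) : ℂ) =
      star (conditionalState b φ) ⬝ᵥ conditionalState b ψ := by
    intro b
    rw [EuclideanSpace.inner_eq_star_dotProduct]
    simp only [Matrix.toLpLin_apply, dotProduct, Matrix.mulVec, hG, Matrix.of_apply,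
      conditionalState, Pi.star_apply, star_sum, star_mul', star_star, Finset.sum_mul,
      Finset.mul_sum]
    rw [Finset.sum_comm]
    conv_lhs => enter [2, i']; rw [Finset.sum_comm]
    rw [Finset.sum_comm]
    refine Finset.sum_congr rfl fun _ _ => ?_
    rw [Finset.sum_comm]
    exact Finset.sum_congr rfl fun _ _ => Finset.sum_congr rfl fun _ _ => by ring
  obtain ⟨b, hb, hb0⟩ := exists_orthonormal_forall_inner_eq_zero (Matrix.toLpLin 2 2 G)
    (EuclideanSpace.basisFun (Fin n) ℂ).orthonormal (by
      rw [← h, EuclideanSpace.inner_eq_star_dotProduct]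
      simp [hG, Matrix.toLpLin_apply, dotProduct, Fintype.sum_prod_type,
        EuclideanSpace.inner_single_left])
  exact ⟨b, hb, fun j => (hT (b j)).symm.trans (hb0 j)⟩

/-- The square matrix `U` with columns `b j` satisfies `Uᴴ * U = 1`, hence also `U * Uᴴ = 1`, which
is the claim. -/
theorem sum_vecMulVec_star_eq_one {b : Fin n → EuclideanSpace ℂ (Fin n)} (hb : Orthonormal ℂ b) :
    ∑ j, Matrix.vecMulVec (b j) (star (WithLp.ofLp (b j))) = 1 := by
  set U : Matrix (Fin n) (Fin n) ℂ := Matrix.of fun i j => b j i with hU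
  have h1 : Uᴴ * U = 1 := by
    ext i j
    have := orthonormal_iff_ite.1 hb i j
    rw [EuclideanSpace.inner_eq_star_dotProduct] at this
    rw [Matrix.one_apply, ← this]
    simp [hU, Matrix.mul_apply, dotProduct, mul_comm]
  rw [← mul_eq_one_comm.1 h1]
  ext i j
  simp [hU, Matrix.mul_apply, Matrix.sum_apply, Matrix.vecMulVec_apply]

/-- Two orthogonal states are perfectly distinguished by some LOCC protocol. -/
theorem exists_protocol_distinguishing {φ ψ : BipartiteSpace n} (h : (inner ℂ φ ψ : ℂ) = 0) :
    ∃ P : LOCCProtocol n, ∀ y, P.prob φ y = 0 ∨ P.prob ψ y = 0 := by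
  obtain ⟨b, hb, hbo⟩ := exists_orthonormal_conditionalState h
  choose R hR1 hR2 hR3 using fun j => exists_projection (hbo j)
  set K : ℕ → Matrix (Fin n) (Fin n) ℂ := fun j =>
    if hj : j < n then Matrix.vecMulVec (b ⟨j, hj⟩) (star (WithLp.ofLp (b ⟨j, hj⟩))) else 0
    with hKdef
  -- Outcome 0 annihilates Bob's conditional state from `ψ`, outcome 1 the one from `φ`. For `j ≥ n`
  -- the pair `1, 0` serves only to satisfy completeness, which `oneWay` requires for every `j`.
  set M : ℕ → ℕ → Matrix (Fin n) (Fin n) ℂ := fun j c =>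
    if hj : j < n then (if c = 0 then R ⟨j, hj⟩ else 1 - R ⟨j, hj⟩)
    else if c = 0 then 1 else 0 with hMdef
  have hK : ∑ j ∈ Finset.range n, (K j)ᴴ * K j = 1 := by
    rw [Finset.sum_range, ← sum_vecMulVec_star_eq_one hb]
    refine Finset.sum_congr rfl fun j _ => ?_
    have hj := orthonormal_iff_ite.1 hb j j
    rw [EuclideanSpace.inner_eq_star_dotProduct, dotProduct_comm, if_pos rfl] at hj
    simp only [hKdef, j.2, dif_pos, Fin.eta]
    rw [Matrix.conjTranspose_vecMulVec, star_star, Matrix.vecMulVec_mul_vecMulVec, hj, one_smul]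
  have hM : ∀ j, ∑ c ∈ Finset.range 2, (M j c)ᴴ * M j c = 1 := fun j => by
    rw [Finset.sum_range_succ, Finset.sum_range_one]
    by_cases hj : j < n
    · simpa [hMdef, hj] using hR1 ⟨j, hj⟩
    · simp [hMdef, hj]
  refine ⟨⟨LOCCInstructions.oneWay n K M hK hM, fun χ hχ => ?_⟩, fun y => ?_⟩
  · simpa [hχ] using LOCCInstructions.hasSum_prob_oneWay (hK := hK) (hM := hM) χ
  · by_cases hy : (LOCCInstructions.oneWay n K M hK hM).IsRecord y
    · obtain ⟨j, hj, c, hc, rfl⟩ := LOCCInstructions.isRecord_oneWay.1 hy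
      have hKj : K j = Matrix.vecMulVec (b ⟨j, hj⟩) (star (WithLp.ofLp (b ⟨j, hj⟩))) := by
        simp [hKdef, hj]
      simp only [LOCCInstructions.prob_oneWay _ hj hc, hKj]
      by_cases hc0 : c = 0
      · right
        have hMj : M j c = R ⟨j, hj⟩ := by simp [hMdef, hj, hc0]
        rw [hMj, kronecker_mulVec_eq_zero (hR2 ⟨j, hj⟩)]
        simp
      · left
        have hMj : M j c = 1 - R ⟨j, hj⟩ := by simp [hMdef, hj, hc0]
        rw [hMj, kronecker_mulVec_eq_zero (hR3 ⟨j, hj⟩)]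
        simp
    · exact Or.inl (LOCCInstructions.prob_of_not_isRecord _ _ hy)

/-! ### Lower bound and conclusion. -/

/-- Under a protocol distinguishing the first two states, each record excludes at least one of them
and so contributes at least `log 2 / k` times the sum of its probabilities on the two. These
probabilities have total 2. -/
theorem exists_protocol_le_protocolInformation (hk : 1 < k) {ψ : Fin k → BipartiteSpace n}
    (hψ : Orthonormal ℂ ψ) :
    ∃ P : LOCCProtocol n, 2 / (k : ℝ) * Real.log 2 ≤ protocolInformation ψ P := by
  set a : Fin k := ⟨0, by omega⟩ with ha
  set b : Fin k := ⟨1, hk⟩ with hb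
  have hab : a ≠ b := by simp [ha, hb]
  obtain ⟨P, hP⟩ := exists_protocol_distinguishing (hψ.2 hab)
  refine ⟨P, ?_⟩
  have hs := (((P.terminates _ (hψ.1 a)).add (P.terminates _ (hψ.1 b))).mul_left
    (1 / (k : ℝ))).mul_right (Real.log 2)
  have hle := hasSum_le (fun y => ?_) hs (hasSum_protocolInformation (by omega) hψ P)
  · refine le_of_eq_of_le ?_ hle
    ring
  · have hx : ∀ i, 0 ≤ 1 / (k : ℝ) * P.prob (ψ i) y := fun i =>
      mul_nonneg (by positivity) (P.prob_nonneg _ _)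
    rcases hP y with h0 | h0
    · have := mul_log_two_le_infoTerm hx hab.symm (by rw [h0, mul_zero])
      simpa [h0] using this
    · have := mul_log_two_le_infoTerm hx hab (by rw [h0, mul_zero])
      simpa [h0] using this

theorem mainTheorem10 (k n : ℕ) (hk : 1 < k) (hkn : k ≤ n ^ 2) :
    (∀ ψ : Fin k → BipartiteSpace n, Orthonormal ℂ ψ →
      IsLUB (Set.range fun P : LOCCProtocol n => protocolInformation ψ P) (loccInformation ψ)) ∧
    IsLeast {x : ℝ | ∃ ψ : Fin k → BipartiteSpace n, Orthonormal ℂ ψ ∧ x = loccInformation ψ}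
      (worstCaseInformation k n) ∧
    2 / (k : ℝ) * Real.log 2 ≤ worstCaseInformation k n ∧
    worstCaseInformation k n ≤ Real.log (⌈Real.sqrt (k : ℝ)⌉₊ : ℝ) := by
  have hk0 : 0 < k := by omega
  obtain ⟨ψ, hψ, hle⟩ := exists_orthonormal_protocolInformation_le hk0 hkn
  -- Only the existence of a protocol matters here: the real supremum is a true least upper bound
  -- for a nonempty bounded set.
  obtain ⟨P₀, -⟩ := exists_protocol_le_protocolInformation hk hψ
  have : Nonempty (LOCCProtocol n) := ⟨P₀⟩
  have hleast := isLeast_worstCaseInformation (n := n) hk0 ⟨ψ, hψ⟩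
  refine ⟨fun φ hφ => isLUB_ciSup (bddAbove_protocolInformation hk0 hφ), hleast, ?_,
    (hleast.2 ⟨ψ, hψ, rfl⟩).trans (ciSup_le hle)⟩
  obtain ⟨φ, hφ, hw⟩ := hleast.1
  obtain ⟨P, hP⟩ := exists_protocol_le_protocolInformation hk hφ
  rw [hw]
  exact hP.trans (le_ciSup (bddAbove_protocolInformation hk0 hφ) P)
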